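/- **Proposition (determinant of Montesinos links).** Conventions. Let $0$ be the tangle with no crossings whose strands join NW to NE and SW to SE, and $\pm1$ the two one-crossing tangles; the sum $s+t$ of tangles joins the NE, SE ends of $s$ to the NW, SW ends of $t$; an integer $n$ also denotes the tangle $n = \pm 1 \pm\cdots\pm 1$; the product $st$ is obtained by reflecting $s$ in the plane through its NW–SE axis (perpendicular to the projection plane) and then adding $t$; the vertical closure $1*t$ joins NW to NE and SW to SE. A rational number $t\neq 0,\pm1$ can be written as $t=\pm[a_m,\dots,a_1]$, where $[a_m,\dots,a_1]=a_m+\cfrac{1}{a_{m-1}+\cfrac{1}{\ddots+\cfrac{1}{a_1}}}$ with integers $a_1\ge 2$, $a_k\ge 1$ for $1<k<m$, and $a_m\ge 0$; the corresponding rational tangle, also denoted $t$, is $((\pm a_1)(\pm a_2)\cdots)(\pm a_m)$ (iterated product of integral tangles, bracketed from the left). For an integer $e$ and rational numbers $t_1,\dots,t_p\ne 0,\pm1$ the Montesinos link is $$M(e;t_1,\dots,t_p)=1*(e+t_1 0+\cdots+t_p 0),$$ where $t_i0$ is the product of the tangle $t_i$ with the tangle $0$. The determinant $\det L\ge 0$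 of a link $L$ is the absolute value of its Alexander polynomial at $-1$; that is, for a diagram with $n$ arcs, the greatest common divisor of the $(n-1)\times(n-1)$ minors of its colouring matrix, whose row at each crossing is $2(\text{over-arc})-(\text{first under-arc})-(\text{second under-arc})$. Statement. Let $p\ge 0$, let $e$ be an integer, and for $i=1,\dots,p$ let $\alpha_i,\beta_i$ be coprime integers with $\beta_i\ne 0$ and $\alpha_i/\beta_i\notin\{0,1,-1\}$. Then $$\det M\!\left(e;\frac{\alpha_1}{\beta_1},\dots,\frac{\alpha_p}{\beta_p}\right)=\left|\left(\prod_{i=1}^p\alpha_i\right)\left(e+\sum_{i=1}^p\frac{\beta_i}{\alpha_i}\right)\right|.$$ -/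

import Mathlib

namespace LinkTheory

/-! ## Diagrams of links and tangles

Diagrams are recorded by planar-diagram codes.  Besides crossings we allow *joints*, that is,
two-valent points at which two edge ends are glued; a crossingless circle is an edge both of whose
ends meet at one joint. -/

/-- The four ends of a tangle. -/
inductive Compass where
  | nw | ne | sw | se
  deriving DecidableEq

instance : Fintype Compass :=
  ⟨{.nw, .ne, .sw, .se}, fun x => by cases x <;> decide⟩

/-- A crossing: the four edges meeting at it in counterclockwise order, starting with an
end of the under-strand.  So `under₁, under₂` form the strand passing below and `over₁, over₂` the
strand passing above. -/
structure Crossing (E : Type) where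
  under₁ : E
  over₁ : E
  under₂ : E
  over₂ : E

namespace Crossing

/-- Rename the edges. -/
def map {E F : Type} (f : E → F) (c : Crossing E) : Crossing F :=
  ⟨f c.under₁, f c.over₁, f c.under₂, f c.over₂⟩

/-- Reflection in a line of the projection plane (equivalently, in the plane through that line
perpendicular to the projection plane): the cyclic order is reversed, and the over-strand
stays the over-strand. -/
def reflect {E : Type} (c : Crossing E) : Crossing E :=
  ⟨c.under₁, c.over₂, c.under₂, c.over₁⟩

/-- The multiset of the four edges at a crossing. -/
def ends {E : Type} (c : Crossing E) : Multiset E :=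
  {c.under₁} + {c.over₁} + {c.under₂} + {c.over₂}

theorem ends_map {E F : Type} (f : E → F) (c : Crossing E) :
    (c.map f).ends = c.ends.map f := by
  simp [ends, map]

theorem ends_reflect {E : Type} (c : Crossing E) : c.reflect.ends = c.ends := by
  simp only [ends, reflect]
  abel

end Crossing

/-- The (unoriented) code of a diagram with free ends indexed by `B`: finitely many edges,
crossings, joints, and the edge at each free end.  Each edge has exactly two ends.  (Planarity is not
imposed on codes; all the codes constructed below are those of diagrams drawn in the plane.) -/
structure Diagram (B : Type) [Fintype B] where
  Edge : Type
  Cross : Type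
  Joint : Type
  [edgeFintype : Fintype Edge]
  [crossFintype : Fintype Cross]
  [jointFintype : Fintype Joint]
  crossing : Cross → Crossing Edge
  joint : Joint → Edge × Edge
  boundary : B → Edge
  two_ends : (∑ c, (crossing c).ends) + (∑ j, ({(joint j).1} + {(joint j).2} : Multiset Edge))
      + (∑ b, ({boundary b} : Multiset Edge)) = 2 • (Finset.univ : Finset Edge).val

attribute [instance] Diagram.edgeFintype Diagram.crossFintype Diagram.jointFintype

/-- Link diagrams have no free ends. -/
abbrev LinkDiagram := Diagram Empty

/-- Tangle diagrams have the four free ends NW, NE, SW, SE. -/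
abbrev Tangle := Diagram Compass

theorem sum_compass {M : Type} [AddCommMonoid M] (f : Compass → M) :
    ∑ b, f b = f .nw + f .ne + f .sw + f .se := by
  have h : (Finset.univ : Finset Compass) = {.nw, .ne, .sw, .se} := rfl
  rw [h]
  simp [add_assoc]

/-! ## Determinant -/

namespace Diagram

/-- Two edges belong to the same arc if they are the two halves of an over-strand at a crossing,
or are glued at a joint. -/
inductive SameArc (D : LinkDiagram) : D.Edge → D.Edge → Prop
  | over (c : D.Cross) : SameArc D (D.crossing c).over₁ (D.crossing c).over₂
  | joint (j : D.Joint) : SameArc D (D.joint j).1 (D.joint j).2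

/-- The arcs of a link diagram: its strands cut only at undercrossings (`Quot` takes the
equivalence relation generated by `SameArc`). -/
def Arc (D : LinkDiagram) : Type := Quot D.SameArc

/-- The arc containing an edge. -/
def arc (D : LinkDiagram) (x : D.Edge) : D.Arc := Quot.mk _ x

noncomputable instance (D : LinkDiagram) : Fintype D.Arc :=
  haveI : Finite D.Arc := Finite.of_surjective D.arc Quot.mk_surjective
  Fintype.ofFinite _

open Classical in
/-- The colouring matrix: one row for each crossing and one column for each arc; the row of a
crossing is `2 (over-arc) - (first under-arc) - (second under-arc)`.  This is the Alexander matrix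
of the Wirtinger presentation at `t = -1`. -/
noncomputable def colouringMatrix (D : LinkDiagram) : Matrix D.Cross D.Arc ℤ :=
  Matrix.of fun c =>
    2 • Pi.single (D.arc (D.crossing c).over₁) (1 : ℤ)
      - Pi.single (D.arc (D.crossing c).under₁) (1 : ℤ)
      - Pi.single (D.arc (D.crossing c).under₂) (1 : ℤ)

/-- The determinant of a link: for a diagram with `n` arcs, the (nonnegative) greatest common
divisor of all `(n - 1) × (n - 1)` minors of the colouring matrix.  For a planar diagram whose
matrix is square, these minors all have the same absolute value.  (Selections with a repeated row or column contribute a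
minor equal to `0`, which does not affect the gcd; if there are too few rows the gcd is `0`.) -/
noncomputable def determinant (D : LinkDiagram) : ℕ :=
  (Finset.univ : Finset ((Fin (Fintype.card D.Arc - 1) → D.Cross) ×
      (Fin (Fintype.card D.Arc - 1) → D.Arc))).gcd
    fun s => (D.colouringMatrix.submatrix s.1 s.2).det.natAbs

end Diagram

/-! ## Operations on tangles -/

namespace Tangle

/-- The tangle `0`: an edge joining NW to NE and an edge joining SW to SE. -/
def zero : Tangle where
  Edge := Bool
  Cross := Empty
  Joint := Empty
  crossing := Empty.elim
  joint := Empty.elim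
  boundary
    | .nw => true
    | .ne => true
    | .sw => false
    | .se => false
  two_ends := by
    rw [sum_compass]
    decide

/-- The tangle `1`: one crossing whose over-strand joins SW to NE. -/
def one : Tangle where
  Edge := Compass
  Cross := Unit
  Joint := Empty
  crossing _ := ⟨.nw, .sw, .se, .ne⟩
  joint := Empty.elim
  boundary := id
  two_ends := by
    rw [sum_compass]
    decide

/-- The tangle `-1`: one crossing whose over-strand joins NW to SE. -/
def negOne : Tangle where
  Edge := Compass
  Cross := Unit
  Joint := Empty
  crossing _ := ⟨.sw, .se, .ne, .nw⟩
  joint := Empty.elim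
  boundary := id
  two_ends := by
    rw [sum_compass]
    decide

/-- The tangle sum `s + t`: the ends NE, SE of `s` are joined to the ends NW, SW of `t`. -/
def sum (s t : Tangle) : Tangle where
  Edge := s.Edge ⊕ t.Edge
  Cross := s.Cross ⊕ t.Cross
  Joint := (s.Joint ⊕ t.Joint) ⊕ Bool
  crossing := Sum.elim (fun c => (s.crossing c).map Sum.inl) (fun c => (t.crossing c).map Sum.inr)
  joint := Sum.elim
    (Sum.elim (fun j => (Sum.inl (s.joint j).1, Sum.inl (s.joint j).2))
      (fun j => (Sum.inr (t.joint j).1, Sum.inr (t.joint j).2)))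
    (fun b => if b then (Sum.inl (s.boundary .ne), Sum.inr (t.boundary .nw))
      else (Sum.inl (s.boundary .se), Sum.inr (t.boundary .sw)))
  boundary
    | .nw => Sum.inl (s.boundary .nw)
    | .ne => Sum.inr (t.boundary .ne)
    | .sw => Sum.inl (s.boundary .sw)
    | .se => Sum.inr (t.boundary .se)
  two_ends := by
    have hs := congrArg (Multiset.mapAddMonoidHom (Sum.inl : s.Edge → s.Edge ⊕ t.Edge)) s.two_ends
    have ht := congrArg (Multiset.mapAddMonoidHom (Sum.inr : t.Edge → s.Edge ⊕ t.Edge)) t.two_ends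
    simp only [map_add, map_sum, map_nsmul, sum_compass, Multiset.coe_mapAddMonoidHom,
      Multiset.map_singleton] at hs ht
    have hu : (Finset.univ : Finset (s.Edge ⊕ t.Edge)).val
        = (Finset.univ : Finset s.Edge).val.map Sum.inl
          + (Finset.univ : Finset t.Edge).val.map Sum.inr := rfl
    rw [hu, smul_add, ← hs, ← ht]
    simp only [Fintype.sum_sum_type, Sum.elim_inl, Sum.elim_inr, Crossing.ends_map, sum_compass,
      Fintype.sum_bool, if_true, Bool.false_eq_true, if_false]
    abel

/-- Reflection of a tangle diagram in (the plane through) its NW-SE axis: the ends NE and SW are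
interchanged. -/
def reflect (s : Tangle) : Tangle where
  Edge := s.Edge
  Cross := s.Cross
  Joint := s.Joint
  crossing c := (s.crossing c).reflect
  joint := s.joint
  boundary
    | .nw => s.boundary .nw
    | .ne => s.boundary .sw
    | .sw => s.boundary .ne
    | .se => s.boundary .se
  two_ends := by
    rw [← s.two_ends]
    simp only [Crossing.ends_reflect, sum_compass]
    abel

/-- The tangle product `s t`: reflect `s` in its NW-SE axis, then add `t`. -/
def prod (s t : Tangle) : Tangle := s.reflect.sum t

/-- The sum `u + ⋯ + u` of `n` copies of `u`; the tangle `0` if `n = 0`. -/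
def copies (u : Tangle) : ℕ → Tangle
  | 0 => zero
  | 1 => u
  | n + 2 => (copies u (n + 1)).sum u

/-- The integral tangle `n`. -/
def integral : ℤ → Tangle
  | Int.ofNat n => copies one n
  | Int.negSucc n => copies negOne (n + 1)

/-- The tangle `a₁ a₂ ⋯ a_m = ((a₁ a₂) ⋯ a_{m-1}) a_m` of integral tangles. -/
def ofWord : List ℤ → Tangle
  | [] => zero
  | a :: w => w.foldl (fun s b => s.prod (integral b)) (integral a)

/-- The vertical closure `1*t`: join NW to NE and SW to SE. -/
def verticalClosure (t : Tangle) : LinkDiagram where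
  Edge := t.Edge
  Cross := t.Cross
  Joint := t.Joint ⊕ Bool
  crossing := t.crossing
  joint := Sum.elim t.joint
    (fun b => if b then (t.boundary .nw, t.boundary .ne) else (t.boundary .sw, t.boundary .se))
  boundary := Empty.elim
  two_ends := by
    rw [← t.two_ends]
    simp only [Fintype.sum_sum_type, Sum.elim_inl, Sum.elim_inr, sum_compass,
      Fintype.sum_bool, if_true, Bool.false_eq_true, if_false, Finset.univ_eq_empty,
      Finset.sum_empty]
    abel

end Tangle

/-! ## Rational numbers and rational tangles -/

/-- The continued fraction `[a_m, …, a₁] = a_m + 1/(a_{m-1} + 1/(⋯ + 1/a₁))` of a word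
`a₁ a₂ ⋯ a_m`. -/
def fraction : List ℤ → ℚ
  | [] => 0
  | a :: w => w.foldl (fun x b => b + x⁻¹) (a : ℚ)

/-- The Conway word of a positive rational: `t = [a_m, …, a₁]` with `a₁ ≥ 2`, `a_k ≥ 1` for
`1 < k < m`, and `a_m ≥ 0`. -/
structure IsPositiveWord (w : List ℤ) (t : ℚ) : Prop where
  ne_nil : w ≠ []
  first : 2 ≤ w.head ne_nil
  middle : ∀ k (h : k < w.length), 0 < k → k + 1 < w.length → 1 ≤ w[k]
  last : 0 ≤ w.getLast ne_nil
  eq : t = fraction w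

/-- `w` is the word of the rational tangle corresponding to `t`: either a positive word for `t`, or
the letterwise negative of a positive word for `-t`. -/
def IsConwayWord (w : List ℤ) (t : ℚ) : Prop :=
  IsPositiveWord w t ∨ ∃ v, IsPositiveWord v (-t) ∧ w = v.map (fun a => -a)

/-- The word `a₁ ⋯ a_m` with `a / b = [a_m, …, a₁]`, obtained by Euclid's algorithm. -/
def euclidWord (a b : ℕ) : List ℤ :=
  if h : b = 0 then []
  else if a % b = 0 then [((a / b : ℕ) : ℤ)]
  else euclidWord b (a % b) ++ [((a / b : ℕ) : ℤ)]
termination_by b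
decreasing_by exact Nat.mod_lt _ (Nat.pos_of_ne_zero h)

/-- The word of the rational tangle corresponding to a rational number `t ≠ 0, ±1`; see
`conwayWord_spec`. -/
def conwayWord (t : ℚ) : List ℤ :=
  if 0 ≤ t then euclidWord t.num.natAbs t.den
  else (euclidWord t.num.natAbs t.den).map (fun a => -a)

theorem fraction_append (w : List ℤ) (hw : w ≠ []) (b : ℤ) :
    fraction (w ++ [b]) = b + (fraction w)⁻¹ := by
  cases w with
  | nil => exact absurd rfl hw
  | cons a w => simp [fraction]

theorem euclidWord_spec (b : ℕ) : ∀ a : ℕ, 0 < b → a.Coprime b → a ≠ 0 → ¬ (a = 1 ∧ b = 1) →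
    IsPositiveWord (euclidWord a b) ((a : ℚ) / b) ∧
      (b < a → 1 ≤ (euclidWord a b).getLastD 0) := by
  induction b using Nat.strong_induction_on with
  | _ b ih =>
    intro a hb hab ha h1
    rw [euclidWord, dif_neg hb.ne']
    split_ifs with hm
    · have hb1 : b = 1 := by
        have := Nat.dvd_of_mod_eq_zero hm
        exact Nat.dvd_one.1 (hab ▸ Nat.dvd_gcd this dvd_rfl)
      subst hb1
      have ha2 : 2 ≤ a := by omega
      refine ⟨⟨by simp, ?_, ?_, ?_, ?_⟩, ?_⟩
      · simp; omega
      · intro k h h0 h2; simp at h2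
      · simp
      · simp [fraction]
      · simp; omega
    · have hr : 0 < a % b := Nat.pos_of_ne_zero hm
      have hlt : a % b < b := Nat.mod_lt _ hb
      have hc : b.Coprime (a % b) := by
        have : (a % b).gcd b = 1 := by rw [← hab]; rw [Nat.gcd_comm a b, Nat.gcd_rec b a]
        rw [Nat.coprime_comm]; exact this
      obtain ⟨⟨g1, g2, g3, g4, g5⟩, g6⟩ := ih (a % b) hlt b hr hc hb.ne' (by omega)
      have g6 := g6 hlt
      set v := euclidWord b (a % b) with hv
      have hvl : 0 < v.length := List.length_pos_iff.2 g1
      refine ⟨⟨by simp, ?_, ?_, ?_, ?_⟩, ?_⟩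
      · rw [List.head_append_of_ne_nil g1]
        exact g2
      · intro k h h0 h2
        rw [List.length_append, List.length_singleton] at h2
        have hk : k < v.length := by omega
        rw [List.getElem_append_left hk]
        by_cases hk2 : k + 1 < v.length
        · exact g3 k hk h0 hk2
        · have e1 : v.getLastD 0 = v[k] := by
            rw [List.getLastD_eq_getLast?, List.getLast?_eq_getElem?]
            have : v.length - 1 = k := by omega
            simp [this, hk]
          rw [← e1]; exact g6
      · simp only [List.getLast_append_singleton]; positivity
      · rw [fraction_append v g1, ← g5, inv_div]
        have hb' : (b : ℚ) ≠ 0 := by exact_mod_cast hb.ne'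
        have := Nat.div_add_mod a b
        have h3 : (a : ℚ) = b * ((a / b : ℕ) : ℚ) + ((a % b : ℕ) : ℚ) := by exact_mod_cast this.symm
        rw [div_eq_iff hb', add_mul, div_mul_cancel₀ _ hb']
        rw [Int.cast_natCast]
        linarith
      · intro hba
        simp only [List.getLastD_concat]
        have : 1 ≤ a / b := (Nat.one_le_div_iff hb).2 hba.le
        exact_mod_cast this

theorem conwayWord_spec (t : ℚ) (h0 : t ≠ 0) (h1 : t ≠ 1) (h2 : t ≠ -1) :
    IsConwayWord (conwayWord t) t := by
  have hn : t.num.natAbs ≠ 0 := by simpa using h0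
  have key : IsPositiveWord (euclidWord t.num.natAbs t.den) ((t.num.natAbs : ℚ) / t.den) := by
    refine (euclidWord_spec _ _ t.pos t.reduced hn ?_).1
    rintro ⟨ha, hb⟩
    have ht := Rat.num_div_den t
    rw [hb] at ht
    rcases Int.natAbs_eq t.num with h | h <;> rw [ha] at h <;> rw [h] at ht
    · exact h1 (by rw [← ht]; norm_num)
    · exact h2 (by rw [← ht]; norm_num)
  have habs : ((t.num.natAbs : ℕ) : ℚ) / t.den = |t| := by
    conv_rhs => rw [← Rat.num_div_den t]
    rw [abs_div, Nat.abs_cast, Nat.cast_natAbs, Int.cast_abs]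
  rw [habs] at key
  unfold conwayWord
  split_ifs with h
  · left
    rwa [abs_of_nonneg h] at key
  · right
    rw [abs_of_neg (not_le.1 h)] at key
    exact ⟨_, key, rfl⟩

/-- The rational tangle corresponding to the rational number `t`. -/
def rationalTangle (t : ℚ) : Tangle := Tangle.ofWord (conwayWord t)

/-- The Montesinos link `M(e; t₁, …, t_p) = 1*(e + t₁0 + ⋯ + t_p0)`. -/
def montesinos {p : ℕ} (e : ℤ) (t : Fin p → ℚ) : LinkDiagram :=
  Tangle.verticalClosure
    ((List.ofFn t).foldl
      (fun s x => s.sum ((rationalTangle x).prod (Tangle.integral 0))) (Tangle.integral e))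

end LinkTheory

/-!
A colouring of a diagram assigns to its arcs elements of an abelian group `A` such that twice the
colour of the over-arc at a crossing is the sum of the colours of the under-arcs.  The colourings
are the homomorphisms to `A` from the cokernel of the colouring matrix, and the gcd of
the minors of size one less than the number of arcs generates the first Fitting ideal of that
cokernel.  Since this ideal depends on the group only (`fittingIdeal_eq_of_span`), the
determinant may be computed from any description of the colourings by generators and relations; if
these consist of one free generator and a square system with matrix `B`, the determinant is `|det B|`
(`determinant_eq_of_colourings`).

The colourings of a rational tangle are `a + l q • w` with two free parameters `a`, `w`, where `l` is
an integral colouring increasing by `d` along the horizontal sides and by `u` along the vertical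
ones (`HasSlope`).  Reflection in the NW-SE axis interchanges `d` and `u`, and adding
the integral tangle `b` replaces `d` by `d + b u`.  So the product with `b` acts on
`d / u` as `x ↦ b + 1 / x`, the pair stays coprime, and the tangle of `α / β` has `(d, u) = (α, β)`
(`hasSlope_rationalTangle_div`).  The tangle `(α / β) 0` therefore has `(d, u) = (β, α)`.

In the sum `e + t₁0 + ⋯ + t_p0` all the summands have the same vertical increment `u`, so
`u = α i • w i` for each `i`, and the horizontal increments add up to `e • u + ∑ i, β i • w i`, which
the vertical closure equates to `0` (`isMontesinosSum_foldl`, `determinant_verticalClosure`).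
The determinant of this system in the unknowns `w i` and `u` is computed by a Schur complement
(`det_montesinosMatrix`).
-/

namespace LinkTheory

open Matrix

/-! ### The first Fitting ideal -/

section Fitting

variable {R M : Type*} [CommRing R] [AddCommGroup M] [Module R M]

/-- The first Fitting ideal of the module generated by a finite family `x`, computed from that
family: it is spanned by the determinants of the square matrices all of whose rows, with at most one
exception, are relations among the `x i`.  Expanding along the exceptional row gives the
minors of size one less than the number of generators of the usual definition. -/
def fittingIdeal {ι : Type*} [Fintype ι] [DecidableEq ι] (x : ι → M) : Ideal R :=
  Ideal.span {d | ∃ A : Matrix ι ι R, {i | ∑ j, A i j • x j ≠ 0}.Subsingleton ∧ A.det = d}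

variable {ι κ : Type*} [Fintype ι] [DecidableEq ι] [Fintype κ] [DecidableEq κ]

theorem det_mem_fittingIdeal {x : ι → M} {A : Matrix ι ι R}
    (hA : {i | ∑ j, A i j • x j ≠ 0}.Subsingleton) : A.det ∈ fittingIdeal (R := R) x :=
  Ideal.subset_span ⟨A, hA, rfl⟩

theorem fittingIdeal_le {x : ι → M} {I : Ideal R}
    (h : ∀ A : Matrix ι ι R, {i | ∑ j, A i j • x j ≠ 0}.Subsingleton → A.det ∈ I) :
    fittingIdeal x ≤ I := by
  refine Ideal.span_le.2 ?_
  rintro _ ⟨A, hA, rfl⟩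
  exact h A hA

theorem fittingIdeal_comp_equiv (x : ι → M) (e : κ ≃ ι) :
    fittingIdeal (R := R) (x ∘ e) = fittingIdeal x := by
  apply le_antisymm
  · refine fittingIdeal_le fun A hA => ?_
    rw [← det_submatrix_equiv_self e.symm A]
    refine det_mem_fittingIdeal fun i hi j hj => e.symm.injective (hA ?_ ?_)
    · simpa [← e.sum_comp] using hi
    · simpa [← e.sum_comp] using hj
  · refine fittingIdeal_le fun A hA => ?_
    rw [← det_submatrix_equiv_self e A]
    refine det_mem_fittingIdeal fun i hi j hj => e.injective (hA ?_ ?_)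
    · simpa [← e.sum_comp (fun j => A _ j • x j)] using hi
    · simpa [← e.sum_comp (fun j => A _ j • x j)] using hj

theorem fittingIdeal_cons {n : ℕ} (x : Fin n → M) (p : Fin n → R) :
    fittingIdeal (R := R) (Fin.cons (∑ j, p j • x j) x : Fin (n + 1) → M) = fittingIdeal x := by
  apply le_antisymm
  · refine fittingIdeal_le fun A hA => ?_
    -- Substituting the combination for the new generator is a column operation on `A`, after which
    -- the last `n` entries of each row that was a relation form a relation among the `x j`.
    let B : Matrix (Fin (n + 1)) (Fin (n + 1)) R :=
      fun i j => A i j + (Fin.cons 0 p : Fin (n + 1) → R) j * A i 0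
    have hB : B.det = A.det := by
      rw [← det_transpose A, ← det_transpose B]
      exact det_eq_of_forall_row_eq_smul_add_const (Fin.cons 0 p) 0 (by simp) (fun i j => rfl)
    rw [← hB, det_succ_column_zero]
    refine Ideal.sum_mem _ fun i _ => Ideal.mul_mem_left _ _ (det_mem_fittingIdeal ?_)
    have key : ∀ r, ∑ j, B r (Fin.succ j) • x j
        = ∑ j, A r j • (Fin.cons (∑ j, p j • x j) x : Fin (n + 1) → M) j := fun r => by
      simp only [B, Fin.cons_succ, add_smul, Finset.sum_add_distrib, Fin.sum_univ_succ,
        Fin.cons_zero, Finset.smul_sum, mul_comm (p _), mul_smul]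
      abel
    intro a ha b hb
    refine Fin.succAbove_right_injective (p := i) (hA ?_ ?_)
    · rw [Set.mem_ofPred_eq, ← key]; exact ha
    · rw [Set.mem_ofPred_eq, ← key]; exact hb
  · refine fittingIdeal_le fun A hA => ?_
    let B : Matrix (Fin (n + 1)) (Fin (n + 1)) R :=
      Fin.cons (Fin.cons 1 fun j => -p j) fun i => Fin.cons 0 (A i)
    have hB : B.det = A.det := by
      rw [det_succ_column_zero, Fin.sum_univ_succ]
      have : B.submatrix (Fin.succAbove 0) Fin.succ = A := by rfl
      rw [this]
      simp [B]
    rw [← hB]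
    apply det_mem_fittingIdeal
    have h0 : ∑ j, B 0 j • (Fin.cons (∑ j, p j • x j) x : Fin (n + 1) → M) j = 0 := by
      simp [B, Fin.sum_univ_succ]
    have h1 : ∀ i : Fin n, ∑ j, B i.succ j • (Fin.cons (∑ j, p j • x j) x : Fin (n + 1) → M) j
        = ∑ j, A i j • x j := fun i => by
      simp [B, Fin.sum_univ_succ]
    intro a ha b hb
    induction a using Fin.cases with
    | zero => exact absurd h0 ha
    | succ a =>
      induction b using Fin.cases with
      | zero => exact absurd h0 hb
      | succ b =>
        rw [Set.mem_ofPred_eq, h1] at ha hb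
        rw [hA ha hb]

theorem fittingIdeal_option (x : Option ι → M)
    (h : x none ∈ Submodule.span R (Set.range (x ∘ some))) :
    fittingIdeal (R := R) x = fittingIdeal (x ∘ some) := by
  obtain ⟨n, ⟨e⟩⟩ : ∃ n, Nonempty (ι ≃ Fin n) := ⟨_, ⟨Fintype.equivFin ι⟩⟩
  obtain ⟨p, hp⟩ := (Submodule.mem_span_range_iff_exists_fun R).1 h
  rw [← fittingIdeal_comp_equiv x ((finSuccEquiv n).trans (Equiv.optionCongr e.symm)),
    ← fittingIdeal_comp_equiv (x ∘ some) e.symm, ← fittingIdeal_cons _ (p ∘ e.symm)]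
  congr 1
  ext i
  induction i using Fin.cases with
  | zero =>
    simp only [Function.comp_apply, Equiv.trans_apply, finSuccEquiv_zero, Fin.cons_zero,
      Equiv.optionCongr_apply, Option.map_none]
    rw [e.symm.sum_comp (fun i => p i • x (some i))]
    exact hp.symm
  | succ i => rfl

theorem fittingIdeal_sum (x : ι → M) (y : κ → M)
    (h : ∀ k, y k ∈ Submodule.span R (Set.range x)) :
    fittingIdeal (R := R) (Sum.elim x y) = fittingIdeal x := by
  obtain ⟨n, ⟨e⟩⟩ : ∃ n, Nonempty (κ ≃ Fin n) := ⟨_, ⟨Fintype.equivFin κ⟩⟩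
  rw [← fittingIdeal_comp_equiv _ ((Equiv.refl ι).sumCongr e.symm)]
  have : Sum.elim x y ∘ ((Equiv.refl ι).sumCongr e.symm) = Sum.elim x (y ∘ e.symm) := by
    ext (i | i) <;> simp
  rw [this]
  have h' : ∀ k, (y ∘ e.symm) k ∈ Submodule.span R (Set.range x) := fun k => h _
  generalize y ∘ e.symm = z at h'
  clear this h e
  induction n with
  | zero =>
    rw [← fittingIdeal_comp_equiv x (Equiv.sumEmpty ι (Fin 0))]
    congr 1
    ext (i | i)
    · simp
    · exact i.elim0
  | succ n ih =>
    rw [← ih (z ∘ Fin.succ) fun k => h' _]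
    let e : Option (ι ⊕ Fin n) ≃ ι ⊕ Fin (n + 1) :=
      (Equiv.optionEquivSumPUnit.{0} _).trans ((Equiv.sumAssoc _ _ _).trans ((Equiv.refl ι).sumCongr
        ((Equiv.optionEquivSumPUnit.{0} _).symm.trans (finSuccEquiv n).symm)))
    have h1 : (Sum.elim x z ∘ e) ∘ some = Sum.elim x (z ∘ Fin.succ) := by
      ext (i | i) <;> simp [e]
    have h2 : (Sum.elim x z ∘ e) none = z 0 := by simp [e]
    rw [← fittingIdeal_comp_equiv _ e, fittingIdeal_option, h1]
    rw [h1, h2]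
    refine Submodule.span_mono ?_ (h' 0)
    rintro _ ⟨i, rfl⟩
    exact ⟨Sum.inl i, rfl⟩

/-- The Fitting ideal depends only on the submodule that the family generates. -/
theorem fittingIdeal_eq_of_span (x : ι → M) (y : κ → M)
    (hy : ∀ k, y k ∈ Submodule.span R (Set.range x))
    (hx : ∀ i, x i ∈ Submodule.span R (Set.range y)) :
    fittingIdeal (R := R) x = fittingIdeal y := by
  rw [← fittingIdeal_sum x y hy, ← fittingIdeal_sum y x hx,
    ← fittingIdeal_comp_equiv (Sum.elim x y) (Equiv.sumComm κ ι)]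
  congr 1
  ext (i | i) <;> rfl

omit [DecidableEq κ] in
theorem det_mul_eq_sum_minors (V : Matrix ι κ R) (W : Matrix κ ι R) :
    (V * W).det = ∑ s : ι → κ, (∏ i, V i (s i)) * (W.submatrix s id).det := by
  have h : V * W = fun i => ∑ c, V i c • W c := by
    ext i j
    simp [mul_apply, Finset.sum_apply]
  have := (detRowAlternating (R := R) (n := ι)).toMultilinearMap.map_sum
    (fun i (c : κ) => V i c • W c)
  rw [h]
  refine Eq.trans this (Finset.sum_congr rfl fun s _ => ?_)
  exact (detRowAlternating (R := R) (n := ι)).toMultilinearMap.map_smul_univ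
    (fun i => V i (s i)) (fun i => W (s i))

/-- If the relations among the `n + 1` elements `x i` are spanned by the rows of `C`, the Fitting
ideal is spanned by the minors of `C` of size `n`. -/
theorem fittingIdeal_eq_span_minors {n : ℕ} (x : Fin (n + 1) → M) (C : Matrix κ (Fin (n + 1)) R)
    (hC : ∀ r : Fin (n + 1) → R, ∑ j, r j • x j = 0 ↔ ∃ v : κ → R, r = v ᵥ* C) :
    fittingIdeal (R := R) x = Ideal.span (Set.range
      fun s : (Fin n → κ) × (Fin n → Fin (n + 1)) => (C.submatrix s.1 s.2).det) := by
  apply le_antisymm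
  · refine fittingIdeal_le fun A hA => ?_
    obtain ⟨i₀, hi₀⟩ : ∃ i₀, ∀ i, i ≠ i₀ → ∑ j, A i j • x j = 0 := by
      by_cases h : ∃ i₀, ∑ j, A i₀ j • x j ≠ 0
      · obtain ⟨i₀, h⟩ := h
        exact ⟨i₀, fun i hi => by_contra fun h' => hi (hA h' h)⟩
      · push Not at h
        exact ⟨0, fun i _ => h i⟩
    have hv : ∀ i : Fin n, ∃ v : κ → R, A (i₀.succAbove i) = v ᵥ* C := fun i =>
      (hC _).1 (hi₀ _ (Fin.succAbove_ne _ _))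
    choose V hV using hv
    rw [det_succ_row A i₀]
    refine Ideal.sum_mem _ fun j _ => Ideal.mul_mem_left _ _ ?_
    have : A.submatrix i₀.succAbove j.succAbove = of V * C.submatrix id j.succAbove := by
      ext a b
      rw [submatrix_apply, hV]
      rfl
    rw [this, det_mul_eq_sum_minors]
    refine Ideal.sum_mem _ fun s _ => Ideal.mul_mem_left _ _ (Ideal.subset_span ?_)
    exact ⟨(s, j.succAbove), rfl⟩
  · rw [Ideal.span_le]
    rintro _ ⟨⟨s, t⟩, rfl⟩
    -- The selection `t` of columns misses some `j`; add the unit row at `j` as exceptional row.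
    obtain ⟨j, hj⟩ : ∃ j, ∀ i, t i ≠ j := by
      by_contra! h
      have := Fintype.card_le_of_surjective t h
      simp at this
    choose σ hσ using fun i => Fin.exists_succAbove_eq (hj i)
    have h1 : C.submatrix s t
        = C.submatrix s j.succAbove * (1 : Matrix (Fin n) (Fin n) R).submatrix id σ := by
      ext a b
      simp [mul_apply, one_apply, ← hσ]
    let A : Matrix (Fin (n + 1)) (Fin (n + 1)) R := Fin.cons (Pi.single j 1) fun i => C (s i)
    have h2 : A.det = (-1) ^ (j : ℕ) * (C.submatrix s j.succAbove).det := by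
      rw [det_succ_row_zero, Finset.sum_eq_single j]
      · simp only [A, Fin.cons_zero, Pi.single_eq_same, mul_one]
        rfl
      · intro b _ hb
        simp [A, hb]
      · simp
    have h3 : (C.submatrix s j.succAbove).det = (-1) ^ (j : ℕ) * A.det := by
      rw [h2, ← mul_assoc, ← mul_pow]
      simp
    simp only [SetLike.mem_coe]
    rw [h1, det_mul, h3]
    refine Ideal.mul_mem_right _ _ (Ideal.mul_mem_left _ _ (det_mem_fittingIdeal ?_))
    have hrow : ∀ i : Fin n, ∑ b, A i.succ b • x b = 0 := fun i =>
      (hC _).2 ⟨Pi.single (s i) 1, by simp [A, Matrix.row]⟩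
    intro a ha b hb
    induction a using Fin.cases with
    | succ a => exact absurd (hrow a) ha
    | zero =>
      induction b using Fin.cases with
      | succ b => exact absurd (hrow b) hb
      | zero => rfl

/-- A module of the form `R ⊕ coker B` with `B` square, the free summand being generated by the
element with index `none`, has first Fitting ideal `(det B)`. -/
theorem fittingIdeal_eq_span_det (g : Option κ → M) (B : Matrix κ κ R)
    (hB : ∀ r : Option κ → R, ∑ j, r j • g j = 0 ↔
      r none = 0 ∧ ∃ v : κ → R, (fun j => r (some j)) = v ᵥ* B) :
    fittingIdeal (R := R) g = Ideal.span {B.det} := by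
  -- Extend `B` by a unit row at `none`: relations are the combinations of the other rows.
  let D : Matrix (Option κ) (Option κ) R := fun i j =>
    i.elim (j.elim 1 fun _ => 0) fun i => j.elim 0 (B i)
  have hD : D.det = B.det := by
    rw [← det_submatrix_equiv_self (Equiv.optionEquivSumPUnit.{0} κ).symm D]
    have : D.submatrix (Equiv.optionEquivSumPUnit.{0} κ).symm (Equiv.optionEquivSumPUnit.{0} κ).symm
        = fromBlocks B 0 0 1 := by
      ext (i | i) (j | j) <;> rw [submatrix_apply] <;> simp [D]
    rw [this, det_fromBlocks_zero₂₁, det_one, mul_one]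
  apply le_antisymm
  · refine fittingIdeal_le fun A hA => ?_
    obtain ⟨i₀, hi₀⟩ : ∃ i₀, ∀ i, i ≠ i₀ → ∑ j, A i j • g j = 0 := by
      by_cases h : ∃ i₀, ∑ j, A i₀ j • g j ≠ 0
      · obtain ⟨i₀, h⟩ := h
        exact ⟨i₀, fun i hi => by_contra fun h' => hi (hA h' h)⟩
      · push Not at h
        exact ⟨none, fun i _ => h i⟩
    have hv : ∀ i, ∃ v : κ → R, i ≠ i₀ →
        A i none = 0 ∧ (fun j => A i (some j)) = v ᵥ* B := fun i => by
      by_cases h : i = i₀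
      · exact ⟨0, fun h' => absurd h h'⟩
      · obtain ⟨h1, v, h2⟩ := (hB _).1 (hi₀ i h)
        exact ⟨v, fun _ => ⟨h1, h2⟩⟩
    choose V hV using hv
    -- Only the entry of the exceptional row in the column `none` contributes.
    let a : Option κ → R := fun j => j.elim 0 fun j => A i₀ (some j)
    let u : Option κ → R := fun j => j.elim 1 fun _ => 0
    have hrow : A i₀ = A i₀ none • u + a := by
      ext (_ | j) <;> simp [u, a]
    have hA' : A.det = A i₀ none * (A.updateRow i₀ u).det := by
      conv_lhs => rw [← updateRow_eq_self A i₀, hrow]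
      rw [det_updateRow_add, det_updateRow_smul]
      rw [det_eq_zero_of_column_eq_zero (A := A.updateRow i₀ a) none, add_zero]
      intro i
      by_cases h : i = i₀
      · subst h; simp [a]
      · rw [updateRow_ne h, (hV i h).1]
    let W : Matrix (Option κ) (Option κ) R := fun i j =>
      if i = i₀ then u j else j.elim 0 (V i)
    have hW : A.updateRow i₀ u = W * D := by
      ext i j
      rw [mul_apply, Fintype.sum_option]
      by_cases h : i = i₀
      · subst h
        cases j <;> simp [W, D, u]
      · rw [updateRow_ne h]
        cases j with
        | none => simp [W, D, h, (hV i h).1]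
        | some j => simpa [W, D, h, vecMul, dotProduct] using congrFun (hV i h).2 j
    rw [hA', hW, det_mul, hD]
    exact Ideal.mul_mem_left _ _ (Ideal.mul_mem_left _ _ (Ideal.mem_span_singleton_self _))
  · rw [Ideal.span_singleton_le_iff_mem, ← hD]
    apply det_mem_fittingIdeal
    have hrow : ∀ i, ∑ j, D (some i) j • g j = 0 := fun i =>
      (hB _).2 ⟨rfl, Pi.single i 1, by ext j; simp [D]⟩
    rintro (_ | i) ha (_ | j) hb
    · rfl
    · exact absurd (hrow j) hb
    · exact absurd (hrow i) ha
    · exact absurd (hrow i) ha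

end Fitting

/-! ### Colourings and the determinant -/

/-- A colouring of a diagram by elements of an abelian group: it is constant along arcs, and at each
crossing twice the colour of the over-arc is the sum of the colours of the two under-arcs. -/
structure IsColouring {B : Type} [Fintype B] (D : Diagram B) {A : Type} [AddCommGroup A]
    (x : D.Edge → A) : Prop where
  over_eq : ∀ c, x (D.crossing c).over₁ = x (D.crossing c).over₂
  under_add : ∀ c, (2 : ℤ) • x (D.crossing c).over₁
    = x (D.crossing c).under₁ + x (D.crossing c).under₂
  joint_eq : ∀ j, x (D.joint j).1 = x (D.joint j).2

/-- The abelian group presented by the rows of an integer matrix, with its universal property. -/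
theorem exists_presented_group {ι κ : Type} [Fintype ι] [DecidableEq ι] [Fintype κ]
    (C : Matrix κ ι ℤ) :
    ∃ (M : Type) (_ : AddCommGroup M) (x : ι → M),
      (∀ r : ι → ℤ, ∑ j, r j • x j = 0 ↔ ∃ v : κ → ℤ, r = v ᵥ* C) ∧
      ∀ (A : Type) [AddCommGroup A] (y : ι → A), (∀ i, ∑ j, C i j • y j = 0) →
        ∃ φ : M →+ A, ∀ j, φ (x j) = y j := by
  let R : AddSubgroup (ι → ℤ) := (LinearMap.range (vecMulLinear C)).toAddSubgroup
  refine ⟨(ι → ℤ) ⧸ R, inferInstance, fun j => QuotientAddGroup.mk' R (Pi.single j 1), ?_, ?_⟩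
  · intro r
    have h1 : ∑ j, r j • QuotientAddGroup.mk' R (Pi.single j 1) = QuotientAddGroup.mk' R r := by
      simp only [← map_zsmul, ← map_sum]
      congr 1
      ext i
      simp [Finset.sum_apply, Pi.single_apply]
    rw [h1, QuotientAddGroup.mk'_apply, QuotientAddGroup.eq_zero_iff]
    simp [R, eq_comm]
  · intro A _ y hy
    let f : (ι → ℤ) →+ A := (Fintype.linearCombination ℤ y).toAddMonoidHom
    have hf : ∀ r, f r = ∑ j, r j • y j := fun r => Fintype.linearCombination_apply ℤ y r
    refine ⟨QuotientAddGroup.lift R f ?_, fun j => ?_⟩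
    · rintro r ⟨v, rfl⟩
      have : ∑ j, (v ᵥ* C) j • y j = ∑ i, v i • ∑ j, C i j • y j := by
        simp only [vecMul, dotProduct, Finset.sum_smul, Finset.smul_sum, mul_smul]
        exact Finset.sum_comm
      simp [hf, this, hy]
    · simp [hf, Pi.single_apply]

theorem colouringMatrix_smul (D : LinkDiagram) {A : Type} [AddCommGroup A] (y : D.Arc → A)
    (c : D.Cross) : ∑ a, D.colouringMatrix c a • y a =
      (2 : ℤ) • y (D.arc (D.crossing c).over₁) - y (D.arc (D.crossing c).under₁)
        - y (D.arc (D.crossing c).under₂) := by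
  classical
  simp [Diagram.colouringMatrix, sub_smul, Finset.sum_sub_distrib, Pi.single_apply, ite_smul]

/-- If the minors of size `card D.Arc - 1` generate the ideal `(b)`, the determinant is `|b|`. -/
theorem determinant_eq_natAbs (D : LinkDiagram) (b : ℤ)
    (h : Ideal.span (Set.range fun s : (Fin (Fintype.card D.Arc - 1) → D.Cross) ×
      (Fin (Fintype.card D.Arc - 1) → D.Arc) => (D.colouringMatrix.submatrix s.1 s.2).det)
        = Ideal.span {b}) : D.determinant = b.natAbs := by
  apply Nat.dvd_antisymm
  · rw [← Int.natCast_dvd, ← Ideal.mem_span_singleton]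
    refine (h ▸ Ideal.span_le.2 ?_ : Ideal.span {b} ≤ Ideal.span {(D.determinant : ℤ)})
      (Ideal.mem_span_singleton_self b)
    rintro _ ⟨s, rfl⟩
    rw [SetLike.mem_coe, Ideal.mem_span_singleton, Int.natCast_dvd]
    exact Finset.gcd_dvd (Finset.mem_univ s)
  · refine Finset.dvd_gcd fun s _ => ?_
    rw [Int.natAbs_dvd_natAbs, ← Ideal.mem_span_singleton, ← h]
    exact Ideal.subset_span ⟨s, rfl⟩

/-- Suppose that the colourings `x` of a link diagram in any abelian group correspond to the
families `g` with `B g = 0` for a square integer matrix `B`, one member `g none` being free,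
by `x = k g` and `g = c x`.  Then the cokernel of the colouring matrix is `ℤ ⊕ coker B`, and
the determinant of the link is `|det B|`. -/
theorem determinant_eq_of_colourings (D : LinkDiagram) [Nonempty D.Edge] {κ : Type} [Fintype κ]
    [DecidableEq κ] (B : Matrix κ κ ℤ) (k : D.Edge → Option κ → ℤ) (c : Option κ → D.Edge → ℤ)
    (hk : ∀ (A : Type) [AddCommGroup A] (x : D.Edge → A), IsColouring D x ↔
      ∃ g : Option κ → A, (∀ i, ∑ j, B i j • g (some j) = 0) ∧ ∀ e, x e = ∑ j, k e j • g j)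
    (hc : ∀ (A : Type) [AddCommGroup A] (g : Option κ → A),
      (∀ i, ∑ j, B i j • g (some j) = 0) → ∀ j, g j = ∑ e, c j e • ∑ i, k e i • g i) :
    D.determinant = B.det.natAbs := by
  classical
  obtain ⟨M, _, x, hx, hM⟩ := exists_presented_group D.colouringMatrix
  have hcol : IsColouring D fun e => x (D.arc e) :=
    { over_eq := fun c => congrArg x (Quot.sound (Diagram.SameArc.over c))
      joint_eq := fun j => congrArg x (Quot.sound (.joint j))
      under_add := fun c => by
        have := (hx (D.colouringMatrix c)).2 ⟨Pi.single c 1, by simp [Matrix.row]⟩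
        rw [colouringMatrix_smul, sub_sub, sub_eq_zero] at this
        exact this }
  obtain ⟨g, hg, hxg⟩ := (hk M _).1 hcol
  have hgx : ∀ j, g j = ∑ e, c j e • x (D.arc e) := fun j => by
    simp only [hxg]
    exact hc M g hg j
  -- The relations among the `g j`: compare with the group they ought to present.
  have hrel : ∀ r : Option κ → ℤ, ∑ j, r j • g j = 0 ↔
      r none = 0 ∧ ∃ v : κ → ℤ, (fun j => r (some j)) = v ᵥ* B := by
    intro r
    constructor
    · intro hr
      let C : Matrix κ (Option κ) ℤ := fun i j => j.elim 0 (B i)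
      obtain ⟨N, _, y, hy, -⟩ := exists_presented_group C
      have hBy : ∀ i, ∑ j, B i j • y (some j) = 0 := fun i => by
        have := (hy (C i)).2 ⟨Pi.single i 1, by simp [Matrix.row]⟩
        simpa [C, Fintype.sum_option] using this
      have hcoly := (hk N fun e => ∑ j, k e j • y j).2 ⟨y, hBy, fun e => rfl⟩
      let z : D.Arc → N := Quot.lift (fun e => ∑ j, k e j • y j) fun a b h => by
        rcases h with c | j
        · exact hcoly.over_eq c
        · exact hcoly.joint_eq j
      have hz : ∀ e, z (D.arc e) = ∑ j, k e j • y j := fun e => rfl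
      obtain ⟨φ, hφ⟩ := hM N z fun i => by
        rw [colouringMatrix_smul, sub_sub, sub_eq_zero]
        exact hcoly.under_add i
      have hφg : ∀ j, φ (g j) = y j := fun j => by
        rw [hgx, hc N y hBy j, map_sum]
        exact Finset.sum_congr rfl fun e _ => by rw [map_zsmul, hφ, hz]
      obtain ⟨v, rfl⟩ := (hy r).1 <| by simpa [map_sum, hφg] using congrArg φ hr
      refine ⟨by simp [vecMul, dotProduct, C], v, ?_⟩
      ext j
      simp [vecMul, dotProduct, C]
    · rintro ⟨h0, v, hv⟩
      have : ∑ j, (v ᵥ* B) j • g (some j) = ∑ i, v i • ∑ j, B i j • g (some j) := by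
        simp only [vecMul, dotProduct, Finset.sum_smul, Finset.smul_sum, mul_smul]
        exact Finset.sum_comm
      rw [Fintype.sum_option, h0, zero_smul, zero_add]
      simp_rw [fun j => congrFun hv j, this, hg]
      simp
  have hspan : fittingIdeal (R := ℤ) x = fittingIdeal g := by
    apply fittingIdeal_eq_of_span
    · intro j
      rw [hgx]
      exact Submodule.sum_mem _ fun e _ => Submodule.smul_mem _ _ (Submodule.subset_span ⟨_, rfl⟩)
    · intro a
      induction a using Quot.ind with
      | mk e =>
        have : x (Quot.mk _ e) = ∑ j, k e j • g j := hxg e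
        rw [this]
        exact Submodule.sum_mem _ fun j _ => Submodule.smul_mem _ _ (Submodule.subset_span ⟨_, rfl⟩)
  apply determinant_eq_natAbs
  rw [← fittingIdeal_eq_span_det g B hrel, ← hspan]
  have : Nonempty D.Arc := ⟨D.arc (Classical.arbitrary _)⟩
  have e : Fin (Fintype.card D.Arc - 1 + 1) ≃ D.Arc := (Fintype.equivFinOfCardEq
    (Nat.sub_add_cancel Fintype.card_pos).symm).symm
  rw [← fittingIdeal_comp_equiv x e,
    fittingIdeal_eq_span_minors (x ∘ e) (D.colouringMatrix.submatrix id e)]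
  · congr 1
    ext d
    constructor
    · rintro ⟨⟨s, t⟩, rfl⟩
      exact ⟨(s, e.symm ∘ t), by simp [Function.comp_def]⟩
    · rintro ⟨⟨s, t⟩, rfl⟩
      exact ⟨(s, e ∘ t), rfl⟩
  · intro r
    have h1 : ∑ j, r j • (x ∘ e) j = ∑ a, r (e.symm a) • x a := by
      rw [← e.sum_comp]
      simp
    rw [h1, hx]
    refine exists_congr fun v => ?_
    constructor
    · intro h
      ext j
      simpa [vecMul, dotProduct] using congrFun h (e j)
    · intro h
      ext a
      rw [h]
      simp [vecMul, dotProduct]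

/-! ### Colourings of sums, reflections and closures -/

theorem isColouring_sum {S T : Tangle} {A : Type} [AddCommGroup A]
    {x : S.Edge ⊕ T.Edge → A} : IsColouring (S.sum T) x ↔
      IsColouring S (fun q => x (Sum.inl q)) ∧ IsColouring T (fun q => x (Sum.inr q)) ∧
        x (Sum.inl (S.boundary .ne)) = x (Sum.inr (T.boundary .nw)) ∧
        x (Sum.inl (S.boundary .se)) = x (Sum.inr (T.boundary .sw)) := by
  constructor
  · rintro ⟨h1, h2, h3⟩
    exact ⟨⟨fun c => h1 (Sum.inl c), fun c => h2 (Sum.inl c), fun j => h3 (Sum.inl (Sum.inl j))⟩,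
      ⟨fun c => h1 (Sum.inr c), fun c => h2 (Sum.inr c), fun j => h3 (Sum.inl (Sum.inr j))⟩,
      h3 (Sum.inr true), h3 (Sum.inr false)⟩
  · rintro ⟨⟨s1, s2, s3⟩, ⟨t1, t2, t3⟩, h1, h2⟩
    exact ⟨Sum.rec s1 t1, Sum.rec s2 t2, Sum.rec (Sum.rec s3 t3) (Bool.rec h2 h1)⟩

theorem isColouring_reflect {S : Tangle} {A : Type} [AddCommGroup A] {x : S.Edge → A} :
    IsColouring S.reflect x ↔ IsColouring S x := by
  constructor
  · rintro ⟨h1, h2, h3⟩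
    exact ⟨fun c => (h1 c).symm, fun c => (congrArg _ (h1 c).symm).trans (h2 c), h3⟩
  · rintro ⟨h1, h2, h3⟩
    exact ⟨fun c => (h1 c).symm, fun c => (congrArg _ (h1 c).symm).trans (h2 c), h3⟩

theorem isColouring_verticalClosure {S : Tangle} {A : Type} [AddCommGroup A] {x : S.Edge → A} :
    IsColouring S.verticalClosure x ↔ IsColouring S x ∧
      x (S.boundary .nw) = x (S.boundary .ne) ∧ x (S.boundary .sw) = x (S.boundary .se) := by
  constructor
  · rintro ⟨h1, h2, h3⟩
    exact ⟨⟨h1, h2, fun j => h3 (Sum.inl j)⟩, h3 (Sum.inr true), h3 (Sum.inr false)⟩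
  · rintro ⟨⟨h1, h2, h3⟩, h4, h5⟩
    exact ⟨h1, h2, Sum.rec h3 (Bool.rec h5 h4)⟩

/-! ### Rational tangles -/

/-- The colourings of the tangle in any abelian group are the maps `q ↦ a + l q • w`, where `l` is a
fixed integral colouring which increases by `d` from NW to NE and from SW to SE, and by
`u` from NW to SW and from NE to SE.  For a rational tangle `d / u` is its fraction. -/
def HasSlope (T : Tangle) (d u : ℤ) : Prop :=
  ∃ l : T.Edge → ℤ, l (T.boundary .nw) = 0 ∧ l (T.boundary .ne) = d ∧ l (T.boundary .sw) = u ∧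
    l (T.boundary .se) = d + u ∧ ∀ (A : Type) [AddCommGroup A] (x : T.Edge → A),
      IsColouring T x ↔ ∃ a w : A, ∀ q, x q = a + l q • w

namespace HasSlope

theorem neg {T : Tangle} {d u : ℤ} (h : HasSlope T d u) : HasSlope T (-d) (-u) := by
  obtain ⟨l, h1, h2, h3, h4, h5⟩ := h
  refine ⟨-l, by simp [h1], by simp [h2], by simp [h3], by simp [h4]; ring, fun A _ x => ?_⟩
  rw [h5]
  constructor <;> rintro ⟨a, w, h⟩ <;> exact ⟨a, -w, fun q => by simp [h]⟩

theorem zero : HasSlope Tangle.zero 0 1 := by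
  refine ⟨fun q : Bool => if q then 0 else 1, rfl, rfl, rfl, rfl,
    fun A _ x => ⟨fun _ => ?_, fun _ => ?_⟩⟩
  · refine ⟨x true, x false - x true, ?_⟩
    rintro (_ | _) <;> simp
  · exact ⟨fun c => c.elim, fun c => c.elim, fun j => j.elim⟩

theorem one : HasSlope Tangle.one 1 1 := by
  refine ⟨fun q => match q with | .nw => 0 | .ne => 1 | .sw => 1 | .se => 2, rfl, rfl, rfl, rfl,
    fun A _ x => ⟨fun h => ?_, ?_⟩⟩
  · have h1 : x .sw = x .ne := h.over_eq ()
    have h2 : (2 : ℤ) • x .sw = x .nw + x .se := h.under_add ()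
    refine ⟨x .nw, x .sw - x .nw, ?_⟩
    rintro (_ | _ | _ | _)
    · simp
    · simp [h1]
    · simp
    · simp only [smul_sub, h2, two_smul]
      abel
  · rintro ⟨a, w, h⟩
    have hnw : x .nw = a + (0 : ℤ) • w := h Compass.nw
    have hne : x .ne = a + (1 : ℤ) • w := h Compass.ne
    have hsw : x .sw = a + (1 : ℤ) • w := h Compass.sw
    have hse : x .se = a + (2 : ℤ) • w := h Compass.se
    refine ⟨fun _ => hsw.trans hne.symm, fun _ => ?_, fun j => j.elim⟩
    change (2 : ℤ) • x .sw = x .nw + x .se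
    rw [hsw, hnw, hse, two_smul, two_smul, zero_smul, one_smul]
    abel

theorem negOne : HasSlope Tangle.negOne (-1) 1 := by
  refine ⟨fun q => match q with | .nw => 0 | .ne => -1 | .sw => 1 | .se => 0, rfl, rfl, rfl, rfl,
    fun A _ x => ⟨fun h => ?_, ?_⟩⟩
  · have h1 : x .se = x .nw := h.over_eq ()
    have h2 : (2 : ℤ) • x .se = x .sw + x .ne := h.under_add ()
    refine ⟨x .nw, x .sw - x .nw, ?_⟩
    rintro (_ | _ | _ | _)
    · simp
    · rw [h1, two_smul, ← sub_eq_iff_eq_add'] at h2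
      rw [← h2, neg_smul, one_smul]
      abel
    · simp
    · simp [h1]
  · rintro ⟨a, w, h⟩
    have hnw : x .nw = a + (0 : ℤ) • w := h Compass.nw
    have hne : x .ne = a + (-1 : ℤ) • w := h Compass.ne
    have hsw : x .sw = a + (1 : ℤ) • w := h Compass.sw
    have hse : x .se = a + (0 : ℤ) • w := h Compass.se
    refine ⟨fun _ => hse.trans hnw.symm, fun _ => ?_, fun j => j.elim⟩
    change (2 : ℤ) • x .se = x .sw + x .ne
    rw [hse, hsw, hne, two_smul, zero_smul, neg_smul, one_smul]
    abel

theorem reflect {T : Tangle} {d u : ℤ} (h : HasSlope T d u) : HasSlope T.reflect u d := by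
  obtain ⟨l, h1, h2, h3, h4, h5⟩ := h
  exact ⟨l, h1, h3, h2, h4.trans (add_comm _ _), fun A _ x => isColouring_reflect.trans (h5 A x)⟩

theorem sum {S T : Tangle} {d u b : ℤ} (hS : HasSlope S d u) (hT : HasSlope T b 1) :
    HasSlope (S.sum T) (d + u * b) u := by
  obtain ⟨l, h1, h2, h3, h4, h5⟩ := hS
  obtain ⟨l', h1', h2', h3', h4', h5'⟩ := hT
  refine ⟨Sum.elim l fun q => d + u * l' q, h1, congrArg (fun t => d + u * t) h2', h3,
    (congrArg (fun t => d + u * t) h4').trans (by ring), fun A _ x => ?_⟩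
  change S.Edge ⊕ T.Edge → A at x
  refine isColouring_sum.trans ?_
  rw [h5, h5']
  change _ ↔ ∃ a w : A, ∀ q : S.Edge ⊕ T.Edge,
    x q = a + (Sum.elim l fun q => d + u * l' q) q • w
  constructor
  · rintro ⟨⟨a, w, h⟩, ⟨a', w', h'⟩, g1, g2⟩
    rw [h, h', h2, h1', zero_smul, add_zero] at g1
    rw [h, h', h4, h3', one_smul, ← g1, add_smul, ← add_assoc, add_right_inj] at g2
    refine ⟨a, w, Sum.rec h fun q => ?_⟩
    rw [h', ← g1, ← g2, Sum.elim_inr, add_smul, mul_comm u, mul_smul, add_assoc]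
  · rintro ⟨a, w, h⟩
    refine ⟨⟨a, w, fun q => h _⟩, ⟨a + d • w, u • w, fun q => ?_⟩, ?_, ?_⟩
    · rw [h, Sum.elim_inr, add_smul, mul_comm u, mul_smul, add_assoc]
    · simp [h, h2, h1']
    · simp [h, h4, h3']

theorem prod {S T : Tangle} {d u b : ℤ} (hS : HasSlope S d u) (hT : HasSlope T b 1) :
    HasSlope (S.prod T) (u + d * b) d :=
  hS.reflect.sum hT

theorem copies {T : Tangle} {b : ℤ} (hT : HasSlope T b 1) :
    ∀ n : ℕ, HasSlope (Tangle.copies T n) (n * b) 1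
  | 0 => by simpa [Tangle.copies] using zero
  | 1 => by simpa [Tangle.copies] using hT
  | n + 2 => by
    have h := (copies hT (n + 1)).sum hT
    have e : ((n + 1 : ℕ) : ℤ) * b + 1 * b = ((n + 2 : ℕ) : ℤ) * b := by push_cast; ring
    rwa [e] at h

theorem integral : ∀ n : ℤ, HasSlope (Tangle.integral n) n 1
  | Int.ofNat n => by simpa [Tangle.integral] using one.copies n
  | Int.negSucc n => by
    have h := negOne.copies (n + 1)
    have e : ((n + 1 : ℕ) : ℤ) * (-1) = Int.negSucc n := by rw [Int.negSucc_eq]; push_cast; ring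
    rwa [e] at h

theorem ofWord_append {w : List ℤ} (hw : w ≠ []) {d u : ℤ} (h : HasSlope (Tangle.ofWord w) d u)
    (b : ℤ) : HasSlope (Tangle.ofWord (w ++ [b])) (u + d * b) d := by
  cases w with
  | nil => exact absurd rfl hw
  | cons a w =>
    have : Tangle.ofWord (a :: w ++ [b]) = (Tangle.ofWord (a :: w)).prod (Tangle.integral b) := by
      simp [Tangle.ofWord]
    rw [this]
    exact h.prod (integral b)

end HasSlope

theorem euclidWord_ne_nil {a b : ℕ} (hb : 0 < b) : euclidWord a b ≠ [] := by
  rw [euclidWord, dif_neg hb.ne']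
  split_ifs <;> simp

/-- Each step of Euclid's algorithm is a step of the product of integral tangles. -/
theorem hasSlope_ofWord_euclidWord (b : ℕ) : ∀ a : ℕ, 0 < b → a.Coprime b →
    HasSlope (Tangle.ofWord (euclidWord a b)) a b ∧
      HasSlope (Tangle.ofWord ((euclidWord a b).map fun c => -c)) (-a) b := by
  induction b using Nat.strong_induction_on with
  | _ b ih =>
    intro a hb hab
    have hdiv : ((a % b : ℕ) : ℤ) + (b : ℤ) * ((a / b : ℕ) : ℤ) = a := by
      exact_mod_cast Nat.mod_add_div a b
    rw [euclidWord, dif_neg hb.ne']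
    split_ifs with hm
    · have hb1 : b = 1 := Nat.dvd_one.1 (hab ▸ Nat.dvd_gcd (Nat.dvd_of_mod_eq_zero hm) dvd_rfl)
      subst hb1
      constructor
      · simpa [Tangle.ofWord] using HasSlope.integral a
      · simpa [Tangle.ofWord] using HasSlope.integral (-a)
    · have hr : 0 < a % b := Nat.pos_of_ne_zero hm
      have hc : b.Coprime (a % b) := by
        rw [Nat.coprime_comm, Nat.Coprime, ← Nat.gcd_rec, Nat.gcd_comm]
        exact hab
      obtain ⟨h1, h2⟩ := ih (a % b) (Nat.mod_lt _ hb) b hr hc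
      constructor
      · have h := h1.ofWord_append (euclidWord_ne_nil hr) ((a / b : ℕ) : ℤ)
        rwa [hdiv] at h
      · have hne : (euclidWord b (a % b)).map (fun c => -c) ≠ [] := by
          simpa using euclidWord_ne_nil hr
        -- The slope pair is only defined up to a common sign.
        have h := (h2.ofWord_append hne (-((a / b : ℕ) : ℤ))).neg
        rw [neg_mul_neg, hdiv, neg_neg] at h
        simpa using h

theorem hasSlope_rationalTangle (t : ℚ) : HasSlope (rationalTangle t) t.num t.den := by
  obtain ⟨h1, h2⟩ := hasSlope_ofWord_euclidWord t.den t.num.natAbs t.pos t.reduced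
  unfold rationalTangle conwayWord
  split_ifs with h
  · rwa [Int.natAbs_of_nonneg (Rat.num_nonneg.2 h)] at h1
  · rwa [Int.ofNat_natAbs_of_nonpos (Rat.num_nonpos.2 (not_le.1 h).le), neg_neg] at h2

theorem hasSlope_rationalTangle_div {α β : ℤ} (h : IsCoprime α β) (hβ : β ≠ 0) :
    HasSlope (rationalTangle ((α : ℚ) / β)) α β := by
  have hc : Nat.Coprime α.natAbs β.natAbs := Int.isCoprime_iff_gcd_eq_one.1 h
  rcases lt_or_gt_of_ne hβ with hβ | hβ
  · have e : (α : ℚ) / β = ((-α : ℤ) : ℚ) / ((-β : ℤ) : ℚ) := by push_cast; rw [neg_div_neg_eq]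
    have hc' : Nat.Coprime (-α).natAbs (-β).natAbs := by simpa using hc
    have := (hasSlope_rationalTangle ((α : ℚ) / β)).neg
    rw [e] at this ⊢
    rw [Rat.num_div_eq_of_coprime (by omega) hc', Rat.den_div_eq_of_coprime (by omega) hc'] at this
    simpa using this
  · have := hasSlope_rationalTangle ((α : ℚ) / β)
    rwa [Rat.num_div_eq_of_coprime hβ hc, Rat.den_div_eq_of_coprime hβ hc] at this

/-! ### Montesinos links -/

/-- The element `a + m • u + ∑ i, l i • w i`: the colour of an edge with coefficients `m` and `l`. -/
def colour {A : Type} [AddCommGroup A] {p : ℕ} (m : ℤ) (l : Fin p → ℤ) (a u : A) (w : Fin p → A) :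
    A :=
  a + m • u + ∑ i, l i • w i

/-- The structure of the colourings of `e + t₁0 + ⋯ + t_p0` with `t_i = α_i / β_i`.  They are
parametrized by the colour `a` of the NW end, the difference `u` between
the SW and NW ends, which is the same for every summand, and one `w i` for each summand with
`α i • w i = u`; from the NW to the NE end of the summand the colour increases by `β i • w i`.
The coefficients `c` recover the `w i` from the colouring. -/
def IsMontesinosSum (S : Tangle) {p : ℕ} (e : ℤ) (α β : Fin p → ℤ) : Prop :=
  ∃ (m : S.Edge → ℤ) (l : S.Edge → Fin p → ℤ) (c : Fin p → S.Edge → ℤ),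
    (∀ (A : Type) [AddCommGroup A] (x : S.Edge → A), IsColouring S x ↔
      ∃ (a u : A) (w : Fin p → A), (∀ i, α i • w i = u) ∧ ∀ q, x q = colour (m q) (l q) a u w) ∧
    ∀ (A : Type) [AddCommGroup A] (x : S.Edge → A) (a u : A) (w : Fin p → A),
      (∀ i, α i • w i = u) → (∀ q, x q = colour (m q) (l q) a u w) →
        x (S.boundary .nw) = a ∧ x (S.boundary .sw) = a + u ∧
        x (S.boundary .ne) = colour e β a u w ∧ x (S.boundary .se) = colour e β a u w + u ∧
        ∀ i, w i = ∑ q, c i q • x q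

theorem colour_snoc {A : Type} [AddCommGroup A] {p : ℕ} (m : ℤ) (l : Fin (p + 1) → ℤ) (a u : A)
    (w : Fin (p + 1) → A) : colour m l a u w =
      colour m (fun i => l i.castSucc) a u (fun i => w i.castSucc)
        + l (Fin.last p) • w (Fin.last p) := by
  simp only [colour, Fin.sum_univ_castSucc, add_assoc]

theorem sum_single_smul {A Q : Type} [AddCommGroup A] [Fintype Q] [DecidableEq Q] (b : Q)
    (x : Q → A) : ∑ q, (Pi.single (M := fun _ => ℤ) b 1 q) • x q = x b := by
  simp [Pi.single_apply]

theorem HasSlope.isMontesinosSum {S : Tangle} {e : ℤ} (h : HasSlope S e 1) (α β : Fin 0 → ℤ) :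
    IsMontesinosSum S e α β := by
  obtain ⟨l, h1, h2, h3, h4, h5⟩ := h
  refine ⟨l, fun _ => ![], Fin.elim0, fun A _ x => ?_, fun A _ x a u w _ hx => ?_⟩
  · rw [h5]
    constructor
    · rintro ⟨a, w, h⟩
      exact ⟨a, w, ![], fun i => i.elim0, by simpa [colour] using h⟩
    · rintro ⟨a, w, _, -, h⟩
      exact ⟨a, w, by simpa [colour] using h⟩
  · simp [hx, colour, h1, h2, h3, h4, add_smul, add_assoc]

theorem IsMontesinosSum.sum {S T : Tangle} {p : ℕ} {e : ℤ} {α β : Fin (p + 1) → ℤ}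
    (hS : IsMontesinosSum S e (fun i => α i.castSucc) fun i => β i.castSucc)
    (hT : HasSlope T (β (Fin.last p)) (α (Fin.last p)))
    (hcop : IsCoprime (α (Fin.last p)) (β (Fin.last p))) :
    IsMontesinosSum (S.sum T) e α β := by
  classical
  obtain ⟨m, l, c, h1, h2⟩ := hS
  obtain ⟨k, k1, k2, k3, k4, h3⟩ := hT
  obtain ⟨γ, δ, hγδ⟩ := hcop
  -- A Bézout combination of the increments along the two sides of `T` recovers the last parameter.
  let c' : T.Edge → ℤ := fun q =>
    γ * (Pi.single (M := fun _ => ℤ) (T.boundary .sw) 1 q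
        - Pi.single (M := fun _ => ℤ) (T.boundary .nw) 1 q)
      + δ * (Pi.single (M := fun _ => ℤ) (T.boundary .ne) 1 q
        - Pi.single (M := fun _ => ℤ) (T.boundary .nw) 1 q)
  have hc' : ∀ (A : Type) [AddCommGroup A] (x : T.Edge → A), ∑ q, c' q • x q =
      γ • (x (T.boundary .sw) - x (T.boundary .nw))
        + δ • (x (T.boundary .ne) - x (T.boundary .nw)) := fun A _ x => by
    simp only [c', add_smul, mul_smul, sub_smul, Finset.sum_add_distrib, Finset.sum_sub_distrib,
      ← Finset.smul_sum, sum_single_smul]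
  let M : S.Edge ⊕ T.Edge → ℤ := Sum.elim m fun _ => e
  let L : S.Edge ⊕ T.Edge → Fin (p + 1) → ℤ :=
    Sum.elim (fun q => Fin.snoc (l q) 0) fun q => Fin.snoc (fun i => β i.castSucc) (k q)
  let C : Fin (p + 1) → S.Edge ⊕ T.Edge → ℤ :=
    Fin.snoc (fun i => Sum.elim (c i) 0) (Sum.elim 0 c')
  have hL1 : ∀ (A : Type) [AddCommGroup A] (a u : A) (w : Fin (p + 1) → A) (q : S.Edge),
      colour (M (Sum.inl q)) (L (Sum.inl q)) a u w
        = colour (m q) (l q) a u fun i => w i.castSucc := fun A _ a u w q => by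
    simp [colour_snoc, L, M]
  have hL2 : ∀ (A : Type) [AddCommGroup A] (a u : A) (w : Fin (p + 1) → A) (q : T.Edge),
      colour (M (Sum.inr q)) (L (Sum.inr q)) a u w
        = colour e (fun i => β i.castSucc) a u (fun i => w i.castSucc)
          + k q • w (Fin.last p) := fun A _ a u w q => by
    simp [colour_snoc, L, M]
  refine ⟨M, L, C, fun A _ x => ?_, fun A _ x a u w hw hx => ?_⟩
  · change S.Edge ⊕ T.Edge → A at x
    refine isColouring_sum.trans ?_
    rw [h1, h3]
    constructor
    · rintro ⟨⟨a, u, w, hw, hx⟩, ⟨a', w', hx'⟩, g1, g2⟩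
      obtain ⟨-, -, f1, f2, -⟩ := h2 A _ a u w hw hx
      rw [f1, hx', k1, zero_smul, add_zero] at g1
      rw [f2, hx', k3, ← g1, add_right_inj] at g2
      refine ⟨a, u, Fin.snoc w w', fun i => ?_, Sum.rec (fun q => ?_) fun q => ?_⟩
      · induction i using Fin.lastCases with
        | last => simp [g2]
        | cast i => simp [hw]
      · rw [hL1, hx]
        simp
      · rw [hL2, hx', ← g1]
        simp
    · rintro ⟨a, u, w, hw, hx⟩
      have hx1 : ∀ q, x (Sum.inl q) = _ := fun q => (hx (Sum.inl q)).trans (hL1 A a u w q)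
      have hx2 : ∀ q, x (Sum.inr q) = _ := fun q => (hx (Sum.inr q)).trans (hL2 A a u w q)
      have hw' : ∀ i : Fin p, α i.castSucc • w i.castSucc = u := fun i => hw _
      obtain ⟨-, -, f1, f2, -⟩ := h2 A (fun q => x (Sum.inl q)) a u _ hw' hx1
      refine ⟨⟨a, u, _, hw', hx1⟩, ⟨_, w (Fin.last p), hx2⟩, ?_, ?_⟩
      · rw [f1, hx2, k1, zero_smul, add_zero]
      · rw [f2, hx2, k3, hw]
  · change S.Edge ⊕ T.Edge → A at x
    have hx1 : ∀ q, x (Sum.inl q) = _ := fun q => (hx (Sum.inl q)).trans (hL1 A a u w q)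
    have hx2 : ∀ q, x (Sum.inr q) = _ := fun q => (hx (Sum.inr q)).trans (hL2 A a u w q)
    have hw' : ∀ i : Fin p, α i.castSucc • w i.castSucc = u := fun i => hw _
    obtain ⟨f1, f2, -, -, f5⟩ := h2 A (fun q => x (Sum.inl q)) a u _ hw' hx1
    refine ⟨f1, f2, ?_, ?_, fun i => ?_⟩
    · change x (Sum.inr (T.boundary .ne)) = _
      rw [hx2, k2, colour_snoc]
    · change x (Sum.inr (T.boundary .se)) = _
      rw [hx2, k4, colour_snoc, add_smul, hw, add_assoc]
    · change w i = ∑ q : S.Edge ⊕ T.Edge, C i q • x q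
      rw [Fintype.sum_sum_type]
      induction i using Fin.lastCases with
      | last =>
        have h0 : ∑ q, C (Fin.last p) (Sum.inl q) • x (Sum.inl q) = 0 := by simp [C]
        have h1 : ∑ q, C (Fin.last p) (Sum.inr q) • x (Sum.inr q)
            = ∑ q, c' q • x (Sum.inr q) := by simp [C]
        rw [h0, h1, zero_add, hc' A fun q => x (Sum.inr q)]
        simp only [hx2, k1, k2, k3, zero_smul, add_zero, add_sub_cancel_left]
        rw [← mul_smul, ← mul_smul, ← add_smul, hγδ, one_smul]
      | cast i => simpa [C] using f5 i

theorem isMontesinosSum_foldl (p : ℕ) (e : ℤ) (α β : Fin p → ℤ)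
    (hcop : ∀ i, IsCoprime (α i) (β i)) (hβ : ∀ i, β i ≠ 0) :
    IsMontesinosSum ((List.ofFn fun i => (α i : ℚ) / (β i : ℚ)).foldl
      (fun s x => s.sum ((rationalTangle x).prod (Tangle.integral 0))) (Tangle.integral e))
      e α β := by
  induction p with
  | zero =>
    rw [List.ofFn_zero]
    exact (HasSlope.integral e).isMontesinosSum α β
  | succ p ih =>
    rw [List.ofFn_succ', List.concat_eq_append, List.foldl_append]
    refine (ih _ _ (fun i => hcop _) fun i => hβ _).sum ?_ (hcop _)
    have := (hasSlope_rationalTangle_div (hcop (Fin.last p)) (hβ _)).prod (HasSlope.integral 0)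
    rwa [mul_zero, add_zero] at this

/-- The relations between the parameters of the colourings of a Montesinos link: `α i • w i = u` for
each `i`, and `e • u + ∑ i, β i • w i = 0` from the vertical closure. -/
def montesinosMatrix {R : Type} [CommRing R] {p : ℕ} (e : R) (α β : Fin p → R) :
    Matrix (Fin p ⊕ Unit) (Fin p ⊕ Unit) R :=
  fromBlocks (diagonal α) (of fun _ _ => -1) (of fun _ i => β i) (of fun _ _ => e)

theorem det_montesinosMatrix {p : ℕ} (e : ℚ) (α β : Fin p → ℚ) (hα : ∀ i, α i ≠ 0) :
    (montesinosMatrix e α β).det = (∏ i, α i) * (e + ∑ i, β i / α i) := by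
  let _ : Invertible (diagonal α) := invertibleOfLeftInverse _ (diagonal fun i => (α i)⁻¹) <| by
    rw [diagonal_mul_diagonal, ← diagonal_one]
    congr 1
    ext i
    exact inv_mul_cancel₀ (hα i)
  have hinv : ⅟(diagonal α) = diagonal fun i => (α i)⁻¹ := rfl
  rw [montesinosMatrix, det_fromBlocks₁₁, det_diagonal, hinv, det_unique]
  congr 1
  simp [mul_apply, diagonal_apply, div_eq_mul_inv]

theorem determinant_verticalClosure {S : Tangle} {p : ℕ} {e : ℤ} {α β : Fin p → ℤ}
    (hS : IsMontesinosSum S e α β) :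
    S.verticalClosure.determinant = (montesinosMatrix e α β).det.natAbs := by
  classical
  obtain ⟨m, l, c, h1, h2⟩ := hS
  have : Nonempty S.verticalClosure.Edge := ⟨S.boundary .nw⟩
  let k : S.Edge → Option (Fin p ⊕ Unit) → ℤ := fun q j =>
    j.elim 1 (Sum.elim (l q) fun _ => m q)
  let C : Option (Fin p ⊕ Unit) → S.Edge → ℤ := fun j =>
    j.elim (Pi.single (S.boundary .nw) 1) (Sum.elim c fun _ =>
      Pi.single (S.boundary .sw) 1 - Pi.single (S.boundary .nw) 1)
  have hk : ∀ (A : Type) [AddCommGroup A] (g : Option (Fin p ⊕ Unit) → A) (q : S.Edge),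
      ∑ j, k q j • g j
        = colour (m q) (l q) (g none) (g (some (.inr ()))) fun i => g (some (.inl i)) := by
    intro A _ g q
    simp only [k, colour, Fintype.sum_option, Fintype.sum_sum_type, Option.elim, Sum.elim_inl,
      Sum.elim_inr, one_smul, Finset.univ_unique, Finset.sum_singleton, add_assoc]
    rw [add_comm (∑ i, _)]
  have hB : ∀ (A : Type) [AddCommGroup A] (g : Option (Fin p ⊕ Unit) → A),
      (∀ i, ∑ j, montesinosMatrix e α β i j • g (some j) = 0) ↔
        (∀ i, α i • g (some (.inl i)) = g (some (.inr ()))) ∧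
          e • g (some (.inr ())) + ∑ i, β i • g (some (.inl i)) = 0 := by
    intro A _ g
    rw [Sum.forall]
    refine and_congr (forall_congr' fun i => ?_) ?_
    · simp [montesinosMatrix, diagonal_apply, ite_smul, ← sub_eq_add_neg, sub_eq_zero]
    · simp [montesinosMatrix, add_comm]
  refine determinant_eq_of_colourings S.verticalClosure (montesinosMatrix e α β) k C
    (fun A _ x => ?_) fun A _ g hg j => ?_
  · change S.Edge → A at x
    refine isColouring_verticalClosure.trans ?_
    rw [h1]
    constructor
    · rintro ⟨⟨a, u, w, hw, hx⟩, g1, g2⟩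
      obtain ⟨f1, f2, f3, f4, -⟩ := h2 A x a u w hw hx
      let g : Option (Fin p ⊕ Unit) → A := fun j => j.elim a (Sum.elim w fun _ => u)
      refine ⟨g, (hB A g).2 ⟨hw, ?_⟩, fun q => ?_⟩
      · rw [f1, f3, colour, add_assoc, left_eq_add] at g1
        exact g1
      · exact (hx q).trans (hk A g q).symm
    · rintro ⟨g, hg, hx⟩
      obtain ⟨hw, hu⟩ := (hB A g).1 hg
      have hx' : ∀ q, x q = _ := fun q => (hx q).trans (hk A g q)
      obtain ⟨f1, f2, f3, f4, -⟩ := h2 A x _ _ _ hw hx'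
      refine ⟨⟨_, _, _, hw, hx'⟩, ?_, ?_⟩
      · rw [f1, f3, colour, add_assoc, hu, add_zero]
      · rw [f2, f4, colour, add_assoc (g none), hu, add_zero]
  · obtain ⟨hw, -⟩ := (hB A g).1 hg
    obtain ⟨f1, f2, -, -, f5⟩ := h2 A (fun q => ∑ j, k q j • g j) _ _ _ hw (hk A g)
    change g j = ∑ q : S.Edge, C j q • ∑ j, k q j • g j
    obtain _ | i | ⟨⟩ := j
    · exact f1.symm.trans (sum_single_smul _ fun q => ∑ j, k q j • g j).symm
    · exact f5 i
    · simp only [C, Option.elim, Sum.elim_inr, Pi.sub_apply, sub_smul, Finset.sum_sub_distrib,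
        sum_single_smul]
      rw [f1, f2, add_sub_cancel_left]

end LinkTheory

theorem proposition4p1 (p : ℕ) (e : ℤ) (α β : Fin p → ℤ)
    (hcop : ∀ i, IsCoprime (α i) (β i)) (hβ : ∀ i, β i ≠ 0)
    (h0 : ∀ i, (α i : ℚ) / (β i : ℚ) ≠ 0)
    (h1 : ∀ i, (α i : ℚ) / (β i : ℚ) ≠ 1)
    (h2 : ∀ i, (α i : ℚ) / (β i : ℚ) ≠ -1) :
    ((LinkTheory.montesinos e (fun i => (α i : ℚ) / (β i : ℚ))).determinant : ℚ) =
      |(∏ i, (α i : ℚ)) * ((e : ℚ) + ∑ i, (β i : ℚ) / (α i : ℚ))| := by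
  open LinkTheory in
  rw [montesinos, determinant_verticalClosure (isMontesinosSum_foldl p e α β hcop hβ),
    ← det_montesinosMatrix _ (fun i => (α i : ℚ)) (fun i => (β i : ℚ))
      fun i hi => h0 i (by simp [hi]), Nat.cast_natAbs, Int.cast_abs]
  congr 1
  have : montesinosMatrix (e : ℚ) (fun i => (α i : ℚ)) (fun i => (β i : ℚ))
      = (montesinosMatrix e α β).map (Int.castRingHom ℚ) := by
    rw [montesinosMatrix, montesinosMatrix, Matrix.fromBlocks_map,
      Matrix.diagonal_map (map_zero _)]
    congr 1
  rw [this]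
  exact (Int.castRingHom ℚ).map_det _
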